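/- Let $d\ge 1$, $r\ge 1$ and $t\ge 0$ be integers. There is a least integer $N=N(d,t,r)$ (the tolerated Tverberg number) such that every finite set $X\subset\mathbb R^d$ with at least $N$ points can be partitioned into $r$ sets $A_1,\dots,A_r$ with the property that $\bigcap_{i=1}^r \operatorname{conv}(A_i\setminus Y)\neq\emptyset$ for every $Y\subseteq X$ with $|Y|\le t$. For fixed $d$ and $r$, $$N(d,t,r) = rt + o(t)\qquad (t\to\infty).$$ Moreover, if $r\ge 2$, then $N(d,t,r)\ge rt+\frac{r(d-2)}{2}$ for every $t\ge 0$. -/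

import Mathlib

/-- The finite set `X ⊂ ℝ^d` can be partitioned into `r` parts `A_1, …, A_r` such that the convex
hulls of the parts still have a common point after the deletion of any at most `t` points of `X`.
(The parts are automatically nonempty, as one sees with `Y = ∅`.) -/
def HasTolerantPartition (d t r : ℕ) (X : Finset (EuclideanSpace ℝ (Fin d))) : Prop :=
  ∃ A : Fin r → Set (EuclideanSpace ℝ (Fin d)),
    Pairwise (fun i j => Disjoint (A i) (A j)) ∧
    (⋃ i, A i) = (X : Set (EuclideanSpace ℝ (Fin d))) ∧
    ∀ Y : Finset (EuclideanSpace ℝ (Fin d)), Y ⊆ X → Y.card ≤ t →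
      (⋂ i, convexHull ℝ (A i \ (Y : Set (EuclideanSpace ℝ (Fin d))))).Nonempty

/-- The set of all `N` such that every set of at least `N` points in `ℝ^d` has a partition into
`r` parts with tolerance `t`. -/
def tolerantTverbergSizes (d t r : ℕ) : Set ℕ :=
  {N | ∀ X : Finset (EuclideanSpace ℝ (Fin d)), N ≤ X.card → HasTolerantPartition d t r X}

/-- The tolerated Tverberg number `N(d, t, r)`, the least element of the set above. -/
noncomputable def tolerantTverbergNumber (d t r : ℕ) : ℕ :=
  sInf (tolerantTverbergSizes d t r)

/-! Upper bound: colour `X` at random with `r` colours. If deleting `Y` destroys the common point,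
separation gives affine `f i` with sum zero and `f i < 0` on `A i \ Y`. The pattern `S = {(x, i) | 0
≤ f i x}` then meets every fibre, yet the graph of the colouring meets `S` only over `Y`.
Sauer–Shelah leaves polynomially many patterns, and a random graph hits each pattern at every point
with probability at least `1 / r`. An exponential-moment union bound yields a good colouring once
`|X|` is large and at least `(r + ε) t`. Lower bound: among too few points of the moment curve, some
part shrinks to at most `d / 2` points after `t` deletions. These span a face, which misses the hull
of any other part. -/

/-- If the convex hulls of finitely many finite sets have no common point, then there are affine
functionals with sum zero, one for each set, each of them negative on its set. -/
theorem exists_affine_functionals_of_iInter_convexHull_empty {ι E : Type*} [Fintype ι]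
    [DecidableEq ι] [Nonempty ι] [NormedAddCommGroup E] [NormedSpace ℝ E]
    (A : ι → Set E) (hA : ∀ i, (A i).Finite)
    (h : ¬ (⋂ i, convexHull ℝ (A i)).Nonempty) :
    ∃ f : ι → Module.Dual ℝ E × ℝ, (∀ x, ∑ i, ((f i).1 x + (f i).2) = 0) ∧
      ∀ i, ∀ x ∈ A i, (f i).1 x + (f i).2 < 0 := by
  by_cases hne : ∀ i, (A i).Nonempty
  · have hC : Convex ℝ (Set.univ.pi fun i => convexHull ℝ (A i)) :=
      convex_pi fun i _ => convex_convexHull ℝ (A i)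
    have hK : IsCompact (Set.univ.pi fun i => convexHull ℝ (A i)) :=
      isCompact_univ_pi fun i => (hA i).isCompact_convexHull ℝ
    have hD : Convex ℝ {a : ι → E | ∀ i j, a i = a j} := by
      intro a ha b hb s t _ _ _ i j
      simp [ha i j, hb i j]
    have hDc : IsClosed {a : ι → E | ∀ i j, a i = a j} := by
      simp only [Set.ofPred_forall]
      exact isClosed_iInter fun i => isClosed_iInter fun j =>
        isClosed_eq (continuous_apply i) (continuous_apply j)
    have hdisj : Disjoint (Set.univ.pi fun i => convexHull ℝ (A i))
        {a : ι → E | ∀ i j, a i = a j} := by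
      rw [Set.disjoint_left]
      intro a ha hd
      obtain ⟨i₀⟩ := ‹Nonempty ι›
      exact h ⟨a i₀, Set.mem_iInter.2 fun i => hd i i₀ ▸ ha i (Set.mem_univ i)⟩
    -- The product of the hulls is separated from the diagonal; the components of `F` become the
    -- linear parts.
    obtain ⟨F, u, v, hu, huv, hv⟩ := geometric_hahn_banach_compact_closed hC hK hD hDc hdisj
    have hv0 : v < 0 := by simpa using hv 0 (by simp)
    have hdiag : ∀ x : E, F (fun _ => x) = 0 := by
      intro x
      by_contra hx
      have := hv ((v / F (fun _ => x)) • fun _ => x) (by simp)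
      rw [map_smul, smul_eq_mul, div_mul_cancel₀ _ hx] at this
      exact lt_irrefl _ this
    have hF : ∀ a : ι → E, F a = ∑ i, F (Pi.single i (a i)) := by
      intro a
      rw [← map_sum, Finset.univ_sum_single]
    choose m hm hmax using fun i =>
      Set.exists_max_image (A i) (fun x => F (Pi.single i x)) (hA i) (hne i)
    have hS : ∑ i, F (Pi.single i (m i)) < 0 := by
      rw [← hF]
      exact ((hu m fun i _ => subset_convexHull ℝ _ (hm i)).trans huv).trans hv0
    set S := ∑ i, F (Pi.single i (m i)) with hSdef
    have hcard : (0 : ℝ) < Fintype.card ι := by exact_mod_cast Fintype.card_pos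
    -- The constants lower every maximum to `S / card ι < 0`, and they sum to `S - S = 0`.
    refine ⟨fun i => ((F : (ι → E) →ₗ[ℝ] ℝ) ∘ₗ LinearMap.single ℝ (fun _ => E) i,
      S / Fintype.card ι - F (Pi.single i (m i))), fun x => ?_, fun i x hx => ?_⟩
    · have := hF fun _ => x
      rw [hdiag] at this
      simp only [LinearMap.comp_apply, LinearMap.coe_single, ContinuousLinearMap.coe_coe]
      rw [Finset.sum_add_distrib, ← this, Finset.sum_sub_distrib, ← hSdef]
      simp only [Finset.sum_const, Finset.card_univ, nsmul_eq_mul]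
      field_simp
      ring
    · have h1 := hmax i x hx
      have h2 := div_neg_of_neg_of_pos hS hcard
      simp only [LinearMap.comp_apply, LinearMap.coe_single, ContinuousLinearMap.coe_coe]
      linarith
  · push Not at hne
    obtain ⟨k, hk⟩ := hne
    refine ⟨fun i => (0, if i = k then (Fintype.card ι : ℝ) - 1 else -1), fun x => ?_,
      fun i x hx => ?_⟩
    · simp [← Finset.add_sum_erase _ _ (Finset.mem_univ k), Finset.sum_ite, Finset.filter_ne',
        Finset.filter_eq', Nat.cast_sub Fintype.card_pos]
    · have : i ≠ k := by
        rintro rfl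
        simp [hk] at hx
      simp [this]

/-! ### Counting sign patterns -/

/-- A set shattered by the nonnegativity patterns of a finite-dimensional space of functions has at
most as many elements as the dimension. -/
theorem card_le_finrank_of_shatters_nonneg {P V : Type*} [DecidableEq P] [AddCommGroup V]
    [Module ℝ V] [FiniteDimensional ℝ V] (e : P → Module.Dual ℝ V) (𝒜 : Finset (Finset P))
    (h𝒜 : ∀ S ∈ 𝒜, ∃ v, ∀ p, p ∈ S ↔ 0 ≤ e p v) {T : Finset P} (hT : 𝒜.Shatters T) :
    T.card ≤ Module.finrank ℝ V := by
  by_contra! hlt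
  have hdep : ¬ LinearIndependent ℝ (fun p : T => e p) := by
    intro hli
    have := hli.fintype_card_le_finrank
    rw [Subspace.dual_finrank_eq, Fintype.card_coe] at this
    omega
  obtain ⟨g, hg, p₀, hp₀⟩ := Fintype.not_linearIndependent_iff.1 hdep
  have hgv : ∀ v, ∑ p, g p * e p v = 0 := fun v => by
    simpa only [LinearMap.sum_apply, LinearMap.smul_apply, smul_eq_mul, LinearMap.zero_apply]
      using LinearMap.congr_fun hg v
  -- Matching nonnegativity patterns makes every term `g p * e p v` nonnegative; only a negative
  -- coefficient forces a strictly positive one.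
  obtain ⟨g, hg, p₀, hp₀⟩ : ∃ g : T → ℝ, (∀ v, ∑ p, g p * e p v = 0) ∧ ∃ p, g p < 0 := by
    rcases lt_or_gt_of_ne hp₀ with h | h
    · exact ⟨g, hgv, p₀, h⟩
    · refine ⟨-g, fun v => ?_, p₀, by simpa using h⟩
      simp only [Pi.neg_apply, neg_mul, Finset.sum_neg_distrib, hgv, neg_zero]
  obtain ⟨S, hS, hTS⟩ := hT (t := T.filter fun p => ∃ hp : p ∈ T, 0 ≤ g ⟨p, hp⟩)
    (Finset.filter_subset _ _)
  obtain ⟨v, hv⟩ := h𝒜 S hS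
  have hmem : ∀ p : T, 0 ≤ e p v ↔ 0 ≤ g p := by
    intro p
    have := Finset.ext_iff.1 hTS p
    simp only [Finset.mem_inter, Finset.mem_filter, p.2, true_and, exists_true_left] at this
    rw [← hv, this]
  have hpos : 0 < ∑ p, g p * e p v := by
    apply Finset.sum_pos'
    · intro p _
      rcases le_or_gt 0 (g p) with h | h
      · exact mul_nonneg h ((hmem p).2 h)
      · have : e p v < 0 := not_le.1 fun h' => h.not_ge ((hmem p).1 h')
        exact (mul_pos_of_neg_of_neg h this).le
    · refine ⟨p₀, Finset.mem_univ _, mul_pos_of_neg_of_neg hp₀ ?_⟩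
      exact not_le.1 fun h' => hp₀.not_ge ((hmem p₀).1 h')
  exact hpos.ne' (hg v)

/-- A finite-dimensional space of functions has polynomially many nonnegativity patterns. -/
theorem card_nonneg_patterns_le {P V : Type*} [Fintype P] [DecidableEq P] [AddCommGroup V]
    [Module ℝ V] [FiniteDimensional ℝ V] (e : P → Module.Dual ℝ V) (𝒜 : Finset (Finset P))
    (h𝒜 : ∀ S ∈ 𝒜, ∃ v, ∀ p, p ∈ S ↔ 0 ≤ e p v) :
    𝒜.card ≤ (Module.finrank ℝ V + 1) * (Fintype.card P + 1) ^ Module.finrank ℝ V := by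
  have hvc : 𝒜.vcDim ≤ Module.finrank ℝ V := Finset.sup_le fun T hT =>
    card_le_finrank_of_shatters_nonneg e 𝒜 h𝒜 (Finset.mem_shatterer.1 hT)
  calc 𝒜.card ≤ ∑ k ∈ Finset.Iic 𝒜.vcDim, (Fintype.card P).choose k :=
        𝒜.card_le_card_shatterer.trans Finset.card_shatterer_le_sum_vcDim
    _ ≤ ∑ k ∈ Finset.Iic (Module.finrank ℝ V), (Fintype.card P).choose k :=
        Finset.sum_le_sum_of_subset (Finset.Iic_subset_Iic.2 hvc)
    _ ≤ ∑ _k ∈ Finset.Iic (Module.finrank ℝ V),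
          (Fintype.card P + 1) ^ Module.finrank ℝ V := by
        refine Finset.sum_le_sum fun k hk => ?_
        calc (Fintype.card P).choose k ≤ Fintype.card P ^ k := Nat.choose_le_pow _ _
          _ ≤ (Fintype.card P + 1) ^ k := Nat.pow_le_pow_left (Nat.le_succ _) _
          _ ≤ _ := Nat.pow_le_pow_right (Nat.succ_pos _) (Finset.mem_Iic.1 hk)
    _ = _ := by simp

/-! ### Random colourings -/

/-- Let `𝒮` be a family of subsets of `X × ι`, each of which meets every fibre `{x} × ι`. If `𝒮` is
small, then some colouring `c : X → ι` has a graph that meets every member of `𝒮` in more than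
`t` points. -/
theorem exists_coloring_lt_card_inter {X ι : Type*} [Fintype X] [Fintype ι] [DecidableEq X]
    [DecidableEq ι] [Nonempty ι] (𝒮 : Finset (Finset (X × ι))) (h𝒮 : ∀ S ∈ 𝒮, ∀ x, ∃ i, (x, i) ∈ S)
    {q : ℝ} (hq : 0 < q) (hq1 : q ≤ 1) (t : ℕ)
    (hlt : (𝒮.card : ℝ) * ((Fintype.card ι - 1 + q) / Fintype.card ι) ^ Fintype.card X < q ^ t) :
    ∃ c : X → ι, ∀ S ∈ 𝒮, t < (Finset.univ.filter fun x => (x, c x) ∈ S).card := by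
  by_contra! hcon
  have hcard : (0 : ℝ) < Fintype.card ι := by exact_mod_cast Fintype.card_pos
  -- The product of these weights along `c` is `q` to the number of hits of `S`.
  let w : Finset (X × ι) → X → ι → ℝ := fun S x i => if (x, i) ∈ S then q else 1
  have hw : ∀ S x i, 0 ≤ w S x i := fun S x i => by
    dsimp only [w]; split_ifs <;> linarith
  have hlow : ∀ c : X → ι, q ^ t ≤ ∑ S ∈ 𝒮, ∏ x, w S x (c x) := by
    intro c
    obtain ⟨S, hS, hle⟩ := hcon c
    calc q ^ t ≤ q ^ (Finset.univ.filter fun x => (x, c x) ∈ S).card :=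
          pow_le_pow_of_le_one hq.le hq1 hle
      _ = ∏ x, w S x (c x) := by simp [w, Finset.prod_ite]
      _ ≤ _ := Finset.single_le_sum (f := fun S => ∏ x, w S x (c x))
          (fun S _ => Finset.prod_nonneg fun x _ => hw S x _) hS
  have hup : ∑ c : X → ι, ∑ S ∈ 𝒮, ∏ x, w S x (c x) ≤
      𝒮.card * (Fintype.card ι - 1 + q) ^ Fintype.card X := by
    rw [Finset.sum_comm, ← nsmul_eq_mul]
    refine Finset.sum_le_card_nsmul _ _ _ fun S hS => ?_
    -- The colours of distinct points are independent, so the sum over colourings factors.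
    have hprod := Finset.prod_univ_sum (fun _ : X => (Finset.univ : Finset ι)) (w S)
    rw [Fintype.piFinset_univ] at hprod
    rw [← hprod, ← Finset.card_univ (α := X), ← Finset.prod_const]
    refine Finset.prod_le_prod (fun x _ => Finset.sum_nonneg fun i _ => hw S x i) fun x _ => ?_
    obtain ⟨i, hi⟩ := h𝒮 S hS x
    rw [← Finset.add_sum_erase _ _ (Finset.mem_univ i)]
    have h1 : ∑ j ∈ Finset.univ.erase i, w S x j ≤ ∑ j ∈ Finset.univ.erase i, (1 : ℝ) :=
      Finset.sum_le_sum fun j _ => by dsimp only [w]; split_ifs <;> linarith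
    rw [Finset.sum_const, Finset.card_erase_of_mem (Finset.mem_univ i), nsmul_eq_mul, mul_one,
      Finset.card_univ, Nat.cast_sub Fintype.card_pos, Nat.cast_one] at h1
    have h2 : w S x i = q := if_pos hi
    linarith
  have hsum := (Finset.card_nsmul_le_sum Finset.univ _ _ fun c _ => hlow c).trans hup
  rw [nsmul_eq_mul, Finset.card_univ, Fintype.card_fun, Nat.cast_pow] at hsum
  rw [div_pow, ← mul_div_assoc, div_lt_iff₀ (by positivity)] at hlt
  linarith

theorem hasTolerantPartition_of_lt {d r t : ℕ} (hr : 1 ≤ r)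
    (X : Finset (EuclideanSpace ℝ (Fin d))) {q : ℝ} (hq : 0 < q) (hq1 : q ≤ 1)
    (hlt : (((Module.finrank ℝ (Fin r → Module.Dual ℝ (EuclideanSpace ℝ (Fin d)) × ℝ) + 1) *
        (X.card * r + 1) ^
          Module.finrank ℝ (Fin r → Module.Dual ℝ (EuclideanSpace ℝ (Fin d)) × ℝ) : ℕ) : ℝ) *
      ((r - 1 + q) / r) ^ X.card < q ^ t) :
    HasTolerantPartition d t r X := by
  classical
  have : Nonempty (Fin r) := ⟨⟨0, hr⟩⟩
  let V := Fin r → Module.Dual ℝ (EuclideanSpace ℝ (Fin d)) × ℝ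
  let e : X × Fin r → Module.Dual ℝ V := fun p =>
    (LinearMap.applyₗ (p.1 : EuclideanSpace ℝ (Fin d)) ∘ₗ LinearMap.fst ℝ _ _ +
      LinearMap.snd ℝ _ _) ∘ₗ LinearMap.proj p.2
  have he : ∀ (p : X × Fin r) (f : V), e p f = (f p.2).1 p.1 + (f p.2).2 := fun p f => rfl
  let 𝒮 : Finset (Finset (X × Fin r)) := Finset.univ.filter fun S =>
    (∃ f : V, ∀ p, p ∈ S ↔ 0 ≤ e p f) ∧ ∀ x, ∃ i, (x, i) ∈ S
  have hcard := card_nonneg_patterns_le e 𝒮 fun S hS => (Finset.mem_filter.1 hS).2.1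
  rw [Fintype.card_prod, Fintype.card_coe, Fintype.card_fin] at hcard
  obtain ⟨c, hc⟩ := exists_coloring_lt_card_inter 𝒮 (fun S hS => (Finset.mem_filter.1 hS).2.2)
    hq hq1 t (by
      rw [Fintype.card_coe, Fintype.card_fin]
      refine lt_of_le_of_lt (mul_le_mul_of_nonneg_right (Nat.cast_le.2 hcard) ?_) hlt
      have : (1 : ℝ) ≤ r := by exact_mod_cast hr
      exact pow_nonneg (div_nonneg (by linarith) (by linarith)) _)
  refine ⟨fun i => Subtype.val '' {x : X | c x = i}, fun i j hij => ?_, ?_, fun Y hY hYt => ?_⟩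
  · refine Set.disjoint_left.2 ?_
    rintro _ ⟨x, hx, rfl⟩ ⟨y, hy, hxy⟩
    obtain rfl := Subtype.val_injective hxy
    exact hij (hx.symm.trans hy)
  · ext x
    simp
  · by_contra hempty
    obtain ⟨f, hf0, hf⟩ := exists_affine_functionals_of_iInter_convexHull_empty _
      (fun i => (((Set.toFinite {x : X | c x = i}).image Subtype.val).sdiff)) hempty
    have hS : (Finset.univ.filter fun p => 0 ≤ e p f) ∈ 𝒮 := by
      refine Finset.mem_filter.2 ⟨Finset.mem_univ _, ⟨f, by simp⟩, fun x => ?_⟩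
      by_contra! hx
      refine (Finset.sum_neg (fun i _ => ?_) Finset.univ_nonempty).ne (hf0 x)
      simpa [he] using hx i
    have hcount := hc _ hS
    refine (hcount.trans_le (le_trans ?_ hYt)).false
    refine Finset.card_le_card_of_injOn Subtype.val (fun x hx => ?_)
      Subtype.val_injective.injOn
    by_contra hxY
    have hneg := hf (c x) x ⟨⟨x, rfl, rfl⟩, hxY⟩
    have hnn : 0 ≤ e (x, c x) f := by simpa using hx
    rw [he] at hnn
    exact hneg.not_ge hnn

/-! ### Lower bound on the moment curve -/

/-- The point `(s, s², …, s^d)` of the moment curve. -/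
noncomputable def momentCurve (d : ℕ) (s : ℝ) : EuclideanSpace ℝ (Fin d) :=
  WithLp.toLp 2 fun i => s ^ ((i : ℕ) + 1)

theorem momentCurve_injective {d : ℕ} (hd : 1 ≤ d) : Function.Injective (momentCurve d) := by
  intro s s' h
  simpa [momentCurve] using congrArg (fun x : EuclideanSpace ℝ (Fin d) => x ⟨0, hd⟩) h

/-- At most `d / 2` points of the moment curve span a face of the convex hull of the curve. -/
theorem exists_functional_lt_on_momentCurve {d : ℕ} (K : Finset ℝ) (hK : 2 * K.card ≤ d) :
    ∃ (f : EuclideanSpace ℝ (Fin d) →ₗ[ℝ] ℝ) (b : ℝ), (∀ s ∈ K, f (momentCurve d s) = b) ∧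
      ∀ s ∉ K, b < f (momentCurve d s) := by
  -- Nonnegative with zero set `K`, and of degree at most `d`, hence affine in the point of the
  -- curve.
  let p : Polynomial ℝ := (∏ s ∈ K, (Polynomial.X - Polynomial.C s)) ^ 2
  have hdeg : p.natDegree < d + 1 := by
    have : p.natDegree ≤ 2 * K.card := by
      refine Polynomial.natDegree_pow_le.trans (Nat.mul_le_mul_left 2 ?_)
      rw [Polynomial.natDegree_finsetProd_X_sub_C_eq_card]
    omega
  have hp : ∀ s, p.eval s = (∏ a ∈ K, (s - a)) ^ 2 := by
    intro s
    simp [p, Polynomial.eval_prod]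
  let f : EuclideanSpace ℝ (Fin d) →ₗ[ℝ] ℝ :=
    ∑ i : Fin d, p.coeff ((i : ℕ) + 1) • (EuclideanSpace.proj i : _ →L[ℝ] ℝ).toLinearMap
  have hf : ∀ s, f (momentCurve d s) = p.eval s - p.coeff 0 := by
    intro s
    rw [Polynomial.eval_eq_sum_range' hdeg, Finset.sum_range_succ', Finset.sum_range]
    simp [f, momentCurve]
  refine ⟨f, -p.coeff 0, fun s hs => ?_, fun s hs => ?_⟩
  · rw [hf, hp, Finset.prod_eq_zero hs (sub_self s)]
    simp
  · have : 0 < p.eval s := by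
      rw [hp]
      exact sq_pos_of_ne_zero (Finset.prod_ne_zero_iff.2 fun a ha =>
        sub_ne_zero.2 (ne_of_mem_of_not_mem ha hs).symm)
    rw [hf]
    linarith

/-- A set of fewer than `r (t + k + 1)` points on the moment curve has no partition into `r` parts
with tolerance `t`, provided that any `k` points of the curve span a face. -/
theorem le_of_mem_tolerantTverbergSizes {d r t k n : ℕ} (hd : 1 ≤ d) (hr : 1 ≤ r)
    (hk : 2 * k ≤ d) (hkr : k = 0 ∨ 2 ≤ r) (hn : n ∈ tolerantTverbergSizes d t r) :
    r * (t + k + 1) ≤ n := by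
  classical
  by_contra! hlt
  have : Nonempty (Fin r) := ⟨⟨0, hr⟩⟩
  have hγ : Function.Injective fun m : ℕ => momentCurve d m :=
    (momentCurve_injective hd).comp Nat.cast_injective
  let X : Finset (EuclideanSpace ℝ (Fin d)) := (Finset.range n).image fun m : ℕ => momentCurve d m
  have hX : X.card = n := by rw [Finset.card_image_of_injective _ hγ, Finset.card_range]
  obtain ⟨A, hdisj, hunion, hA⟩ := hn X hX.ge
  let B : Fin r → Finset (EuclideanSpace ℝ (Fin d)) := fun i => X.filter (· ∈ A i)
  have hAX : ∀ i, A i ⊆ X := fun i => hunion ▸ Set.subset_iUnion A i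
  have hB : ∀ i, (B i : Set (EuclideanSpace ℝ (Fin d))) = A i := by
    intro i
    ext x
    simpa [B] using @hAX i x
  have hsum : ∑ i, (B i).card ≤ n := by
    rw [← hX, ← Finset.card_biUnion]
    · exact Finset.card_le_card (Finset.biUnion_subset.2 fun i _ => Finset.filter_subset _ _)
    · intro i _ j _ hij
      rw [Function.onFun, ← Finset.disjoint_coe, hB, hB]
      exact hdisj hij
  obtain ⟨i, hi⟩ : ∃ i, (B i).card ≤ t + k := by
    by_contra! hcon
    have := Finset.card_nsmul_le_sum Finset.univ (fun i => (B i).card) (t + k + 1)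
      fun i _ => hcon i
    rw [Finset.card_univ, Fintype.card_fin, smul_eq_mul] at this
    omega
  obtain ⟨Y, hYB, hY⟩ := Finset.exists_subset_card_eq (min_le_right t (B i).card)
  obtain ⟨p, hp⟩ := hA Y (hYB.trans (Finset.filter_subset _ _)) (by omega)
  rw [Set.mem_iInter] at hp
  have hrem : (B i \ Y).card ≤ k := by
    rw [Finset.card_sdiff_of_subset hYB]
    omega
  have hpi := hp i
  rw [← hB, ← Finset.coe_sdiff] at hpi
  -- For `k = 0` the part is emptied and no second part is needed, which covers `r = 1`.
  rcases hkr with rfl | hr2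
  · rw [Finset.card_eq_zero.1 (Nat.le_zero.1 hrem)] at hpi
    simp at hpi
  · have : Nontrivial (Fin r) := Fin.nontrivial_iff_two_le.2 hr2
    obtain ⟨j, hji⟩ := exists_ne i
    let K : Finset ℝ := (B i \ Y).preimage (momentCurve d) (momentCurve_injective hd).injOn
    have hK : K.card ≤ k := by
      refine le_trans (Finset.card_le_card_of_injOn (momentCurve d) (fun s hs => ?_)
        (momentCurve_injective hd).injOn) hrem
      exact Finset.mem_preimage.1 hs
    obtain ⟨f, b, hfK, hfpos⟩ := exists_functional_lt_on_momentCurve K (d := d) (by omega)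
    have h1 : f p ≤ b := by
      refine convexHull_min (t := {x | f x ≤ b}) ?_ (convex_halfSpace_le f.isLinear b) hpi
      intro x hx
      obtain ⟨m, -, rfl⟩ := Finset.mem_image.1
        (Finset.filter_subset _ _ (Finset.sdiff_subset (Finset.mem_coe.1 hx)))
      exact (hfK m (Finset.mem_preimage.2 hx)).le
    have h2 : b < f p := by
      refine convexHull_min (t := {x | b < f x}) ?_ (convex_halfSpace_gt f.isLinear b) (hp j)
      intro x hx
      obtain ⟨m, -, rfl⟩ := Finset.mem_image.1 (hAX j hx.1)
      refine hfpos m fun hm => ?_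
      have hmB := Finset.mem_coe.2 (Finset.sdiff_subset (Finset.mem_preimage.1 hm))
      rw [hB] at hmB
      exact Set.disjoint_left.1 (hdisj hji) hx.1 hmB
    exact h1.not_gt h2

/-! ### Asymptotics -/

/-- Near `q = 1` the logarithm of the left side is about `log q / r`, so the smaller exponent `1 /
(r + ε)` leaves room. The growth rate of the exponential moment thus beats that of `q ^ t`. -/
theorem exists_weight_div_lt_rpow {r : ℕ} (hr : 1 ≤ r) {ε : ℝ} (hε : 0 < ε) :
    ∃ q : ℝ, 0 < q ∧ q ≤ 1 ∧ (r - 1 + q) / r < q ^ (r + ε)⁻¹ := by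
  have hr' : (1 : ℝ) ≤ r := by exact_mod_cast hr
  have hr0 : (0 : ℝ) < r := by linarith
  set q : ℝ := r / (r + ε / 2) with hq
  have hq0 : 0 < q := by positivity
  have hq1 : q < 1 := by rw [hq, div_lt_one (by positivity)]; linarith
  refine ⟨q, hq0, hq1.le, ?_⟩
  have hρ : 0 < (r - 1 + q) / r := div_pos (by linarith) hr0
  rw [← Real.log_lt_log_iff hρ (Real.rpow_pos_of_pos hq0 _), Real.log_rpow hq0]
  have h1 : Real.log ((r - 1 + q) / r) ≤ -((1 - q) / r) := by
    refine (Real.log_le_sub_one_of_pos hρ).trans_eq ?_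
    field_simp
    ring
  have h2 : -(ε / 2 / r) ≤ Real.log q := by
    refine le_trans (le_of_eq ?_) (Real.one_sub_inv_le_log_of_pos hq0)
    rw [hq]
    field_simp
    ring
  have h3 : -((1 - q) / r) = -(ε / 2 / r) * (r + ε / 2)⁻¹ := by
    rw [hq]
    field_simp
    ring
  calc Real.log ((r - 1 + q) / r) ≤ -(ε / 2 / r) * (r + ε / 2)⁻¹ := h1.trans_eq h3
    _ < -(ε / 2 / r) * (r + ε)⁻¹ := by
        refine mul_lt_mul_of_neg_left ?_ (by simp; positivity)
        exact inv_strictAnti₀ (by positivity) (by linarith)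
    _ ≤ (r + ε)⁻¹ * Real.log q := by
        rw [mul_comm]
        exact mul_le_mul_of_nonneg_left h2 (by positivity)

/-- All large sets have a partition with tolerance close to the `r`-th part of their size. -/
theorem exists_forall_hasTolerantPartition (d : ℕ) {r : ℕ} (hr : 1 ≤ r) {ε : ℝ} (hε : 0 < ε) :
    ∃ n₀ : ℕ, ∀ (t : ℕ) (X : Finset (EuclideanSpace ℝ (Fin d))), n₀ ≤ X.card →
      (r + ε) * t ≤ X.card → HasTolerantPartition d t r X := by
  obtain ⟨q, hq0, hq1, hq⟩ := exists_weight_div_lt_rpow hr hε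
  have hr' : (1 : ℝ) ≤ r := by exact_mod_cast hr
  set D := Module.finrank ℝ (Fin r → Module.Dual ℝ (EuclideanSpace ℝ (Fin d)) × ℝ) with hD
  set σ := q ^ (r + ε)⁻¹ with hσ
  have hσ0 : 0 < σ := Real.rpow_pos_of_pos hq0 _
  set ρ := (r - 1 + q) / r with hρ
  have hρ0 : 0 < ρ := div_pos (by linarith) (by linarith)
  have hlim := (tendsto_pow_const_mul_const_pow_of_abs_lt_one D (r := ρ / σ)
    (by rwa [abs_of_pos (div_pos hρ0 hσ0), div_lt_one hσ0])).const_mul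
      (((D + 1 : ℕ) : ℝ) * (r + 1) ^ D)
  rw [mul_zero] at hlim
  obtain ⟨n₁, hn₁⟩ := Filter.eventually_atTop.1 (hlim.eventually_lt_const one_pos)
  refine ⟨max n₁ 1, fun t X hX ht => hasTolerantPartition_of_lt hr X hq0 hq1 ?_⟩
  set n := X.card
  have hlt := hn₁ n ((le_max_left _ _).trans hX)
  have hn1 : (1 : ℝ) ≤ n := by exact_mod_cast (le_max_right _ _).trans hX
  rw [div_pow, ← mul_assoc, ← mul_div_assoc, div_lt_one (by positivity)] at hlt
  calc (((D + 1) * (n * r + 1) ^ D : ℕ) : ℝ) * ρ ^ n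
      ≤ ((D + 1 : ℕ) : ℝ) * (r + 1) ^ D * (n : ℝ) ^ D * ρ ^ n := by
        refine mul_le_mul_of_nonneg_right ?_ (by positivity)
        rw [mul_assoc, ← mul_pow]
        push_cast
        gcongr
        linarith
    _ < σ ^ n := hlt
    _ = q ^ ((r + ε)⁻¹ * n) := by rw [hσ, ← Real.rpow_natCast, ← Real.rpow_mul hq0.le]
    _ ≤ q ^ (t : ℝ) := by
        refine Real.rpow_le_rpow_of_exponent_ge hq0 hq1 ?_
        rwa [inv_mul_eq_div, le_div_iff₀' (by positivity)]
    _ = q ^ t := Real.rpow_natCast q t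

theorem exists_forall_mem_tolerantTverbergSizes (d : ℕ) {r : ℕ} (hr : 1 ≤ r) {ε : ℝ}
    (hε : 0 < ε) :
    ∃ n₀ : ℕ, ∀ t, n₀ + ⌈(r + ε) * t⌉₊ ∈ tolerantTverbergSizes d t r := by
  obtain ⟨n₀, hn₀⟩ := exists_forall_hasTolerantPartition d hr hε
  refine ⟨n₀, fun t X hX => hn₀ t X ((Nat.le_add_right _ _).trans hX) ?_⟩
  exact (Nat.le_ceil _).trans (Nat.cast_le.2 ((Nat.le_add_left _ _).trans hX))

theorem theorem1 (d r : ℕ) (hd : 1 ≤ d) (hr : 1 ≤ r) :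
    (∀ t : ℕ, IsLeast (tolerantTverbergSizes d t r) (tolerantTverbergNumber d t r)) ∧
    (2 ≤ r → ∀ t : ℕ,
      (r : ℝ) * t + (r : ℝ) * ((d : ℝ) - 2) / 2 ≤ (tolerantTverbergNumber d t r : ℝ)) ∧
    (fun t : ℕ => (tolerantTverbergNumber d t r : ℝ) - (r : ℝ) * t)
      =o[Filter.atTop] (fun t : ℕ => (t : ℝ)) := by
  have hmem : ∀ t : ℕ, tolerantTverbergNumber d t r ∈ tolerantTverbergSizes d t r := by
    intro t
    obtain ⟨n₀, hn₀⟩ := exists_forall_mem_tolerantTverbergSizes d hr one_pos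
    exact Nat.sInf_mem ⟨_, hn₀ t⟩
  refine ⟨fun t => ⟨hmem t, fun n hn => Nat.sInf_le hn⟩, fun hr2 t => ?_, ?_⟩
  · have h := le_of_mem_tolerantTverbergSizes hd hr (Nat.mul_div_le d 2) (Or.inr hr2) (hmem t)
    have hR : (r : ℝ) * (t + (d / 2 : ℕ) + 1) ≤ tolerantTverbergNumber d t r := by
      exact_mod_cast h
    have hd2 : (d : ℝ) ≤ 2 * (d / 2 : ℕ) + 1 := by
      have : d ≤ 2 * (d / 2) + 1 := by omega
      exact_mod_cast this
    have hr0 : (0 : ℝ) ≤ r := r.cast_nonneg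
    nlinarith [mul_le_mul_of_nonneg_left hd2 hr0]
  · rw [Asymptotics.isLittleO_iff]
    intro c hc
    obtain ⟨n₀, hn₀⟩ := exists_forall_mem_tolerantTverbergSizes d hr (half_pos hc)
    -- Half of `c` pays for `ε`, the other half for `n₀` and the rounding.
    filter_upwards [tendsto_natCast_atTop_atTop.eventually_ge_atTop ((n₀ + 1) / (c / 2))]
      with t ht
    rw [div_le_iff₀ (half_pos hc)] at ht
    have hlow : (r : ℝ) * (t + 0 + 1) ≤ tolerantTverbergNumber d t r := by
      exact_mod_cast le_of_mem_tolerantTverbergSizes hd hr (Nat.zero_le d) (Or.inl rfl) (hmem t)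
    have hup : (tolerantTverbergNumber d t r : ℝ) ≤ n₀ + ⌈(r + c / 2) * t⌉₊ := by
      exact_mod_cast Nat.sInf_le (hn₀ t)
    have hceil := Nat.ceil_lt_add_one (a := (r + c / 2) * t) (by positivity)
    have hr0 : (0 : ℝ) ≤ r := r.cast_nonneg
    rw [Real.norm_of_nonneg (by linarith), Real.norm_of_nonneg t.cast_nonneg]
    linarith
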